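/- Let $\zeta$ be the Riemann zeta function, $\Gamma$ the Gamma function and $\gamma$ the Euler--Mascheroni constant. The series and the integrals below converge (the integrals absolutely), and $$\int_{-\infty}^{\infty}\zeta\left(\tfrac12+iv\right)^{2}\,\Gamma\left(\tfrac12+iv\right)2^{-iv}\,dv=\sqrt{2}\,\pi\left(2\sum_{j=1}^{\infty}\frac{1}{e^{2j}-1}-\gamma+\ln 2\right),$$ and, in real form, $$\int_{-\infty}^{\infty}\frac{\left|\zeta\left(\frac12+iv\right)\right|^{2}}{\cosh(\pi v)}\left(\sinh\left(\tfrac{\pi v}{2}\right)\sin(v\ln\pi)-\cosh\left(\tfrac{\pi v}{2}\right)\cos(v\ln\pi)\right)dv=-\sqrt{2\pi}\left(2\sum_{j=1}^{\infty}\frac{1}{e^{2j}-1}-\gamma+\ln 2\right).$$ -/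

import Mathlib

open Filter Topology MeasureTheory Set

namespace ZetaSquareIntegral

/-! Write s = 1/2 + iv and b(t) = 1/(e^t - 1) - 1/t. In the strip 0 < Re s < 1 the product ζ(s)Γ(s)
is the Mellin transform of b (`mellin_boseKernel`), so Mellin inversion gives ∫ ζΓ x^(-s) dv = 2π
b(x) (`integral_zetaGamma_mul_cpow`). The second factor ζ is the limit of Z_N(s) = ∑_{k ≤ N} k^(-s)
- N^(1-s)/(1-s), which is O(1 + |v|) uniformly in N, while Γ decays exponentially; dominated
convergence therefore lets Z_N stand in for it. Inverting term by term at x = 2k, and using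
N^(1-s)/(1-s) = ∫_0^N x^(-s) dx with Fubini, gives 2π(∑_{k ≤ N} b(2k) - ∫_0^N b(2x) dx). The
integral has a logarithmic primitive, and H_N - log N supplies γ
(`tendsto_sum_boseKernel_sub_integral`).

The real form is the real part of the first: `zeta_sq_Gamma_eq` uses the functional equation to
replace ζ² by |ζ|² times explicit factors. -/

/-! ### Approximating ζ by corrected partial sums for Re s > 0 -/

/-- The increment of `(s - 1) * (∑ k ≤ x, k ^ (-s) - x ^ (1 - s) / (1 - s))` from `x = n + 1`
to `x = n + 2`. -/
noncomputable def zetaIncrement (n : ℕ) (s : ℂ) : ℂ :=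
  (s - 1) * ((n + 2 : ℝ) : ℂ) ^ (-s) + ((n + 2 : ℝ) : ℂ) ^ (1 - s) - ((n + 1 : ℝ) : ℂ) ^ (1 - s)

lemma hasDerivAt_ofReal_cpow_of_pos {x : ℝ} (hx : 0 < x) (r : ℂ) :
    HasDerivAt (fun y : ℝ => (y : ℂ) ^ r) (r * (x : ℂ) ^ (r - 1)) x :=
  ((hasDerivAt_id (x : ℂ)).cpow_const (c := r) (by simp [hx])).comp_ofReal.congr_deriv (by simp)

lemma norm_cpow_neg_sub_le {s : ℂ} (hs : 0 < s.re) {a x b : ℝ} (ha : 0 < a) (hx : x ∈ Icc a b) :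
    ‖(b : ℂ) ^ (-s) - (x : ℂ) ^ (-s)‖ ≤ ‖s‖ * a ^ (-s.re - 1) * (b - a) := by
  have h := Convex.norm_image_sub_le_of_norm_hasDerivWithin_le (s := Icc a b)
    (f := fun y : ℝ => (y : ℂ) ^ (-s)) (f' := fun y : ℝ => -s * (y : ℂ) ^ (-s - 1))
    (C := ‖s‖ * a ^ (-s.re - 1)) (x := x) (y := b)
    (fun y hy => (hasDerivAt_ofReal_cpow_of_pos (ha.trans_le hy.1) _).hasDerivWithinAt)
    (fun y hy => by
      rw [norm_mul, norm_neg, Complex.norm_cpow_eq_rpow_re_of_pos (ha.trans_le hy.1)]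
      gcongr
      simpa using Real.rpow_le_rpow_of_nonpos ha hy.1 (by linarith : -s.re - 1 ≤ 0))
    (convex_Icc a b) hx ⟨hx.1.trans hx.2, le_rfl⟩
  refine h.trans ?_
  gcongr
  rw [Real.norm_of_nonneg (by linarith [hx.2])]
  linarith [hx.1]

/-- The increment is the change over [n + 1, n + 2] of a function with derivative (s - 1)((n +
2)^(-s) - y^(-s)), a difference already of size n^(-σ-1). Keeping ‖s - 1‖ explicit lets it cancel on
division by s - 1. -/
lemma norm_zetaIncrement_le {s : ℂ} (hs : 0 < s.re) (n : ℕ) :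
    ‖zetaIncrement n s‖ ≤ ‖s - 1‖ * ‖s‖ * ((n : ℝ) + 1) ^ (-s.re - 1) := by
  have ha : (0 : ℝ) < n + 1 := by positivity
  have h := Convex.norm_image_sub_le_of_norm_hasDerivWithin_le (s := Icc (n + 1 : ℝ) (n + 2))
    (f := fun y : ℝ => (s - 1) * y * ((n + 2 : ℝ) : ℂ) ^ (-s) + (y : ℂ) ^ (1 - s))
    (f' := fun y : ℝ => (s - 1) * (((n + 2 : ℝ) : ℂ) ^ (-s) - (y : ℂ) ^ (-s)))
    (C := ‖s - 1‖ * (‖s‖ * ((n : ℝ) + 1) ^ (-s.re - 1))) (x := n + 1) (y := n + 2)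
    (fun y hy => by
      have h1 := hasDerivAt_ofReal_cpow_of_pos (ha.trans_le hy.1) (1 - s)
      have h2 : HasDerivAt (fun y : ℝ => (s - 1) * y * ((n + 2 : ℝ) : ℂ) ^ (-s))
          ((s - 1) * ((n + 2 : ℝ) : ℂ) ^ (-s)) y := by
        simpa using ((hasDerivAt_id y).ofReal_comp.const_mul (s - 1)).mul_const
          (((n + 2 : ℝ) : ℂ) ^ (-s))
      refine ((h2.add h1).congr_deriv ?_).hasDerivWithinAt
      rw [show (1 - s - 1) = -s by ring]
      ring)
    (fun y hy => by
      rw [norm_mul]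
      gcongr
      refine (norm_cpow_neg_sub_le hs ha hy).trans_eq ?_
      ring)
    (convex_Icc _ _) ⟨le_rfl, by linarith⟩ ⟨by linarith, le_rfl⟩
  have e1 : ‖((n : ℝ) + 2) - (n + 1)‖ = 1 := by
    rw [show ((n : ℝ) + 2) - (n + 1) = 1 by ring]; simp
  rw [e1, mul_one, ← mul_assoc] at h
  refine le_of_eq_of_le (congrArg norm ?_) h
  rw [zetaIncrement]
  push_cast
  ring

lemma summable_add_one_rpow {σ : ℝ} (hσ : 0 < σ) :
    Summable fun n : ℕ => ((n : ℝ) + 1) ^ (-σ - 1) := by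
  have := (summable_nat_add_iff 1).2 (Real.summable_nat_rpow (p := -σ - 1)|>.2 (by linarith))
  simpa using this

lemma differentiable_zetaIncrement (n : ℕ) : Differentiable ℂ (zetaIncrement n) := by
  have h1 : ((n + 1 : ℝ) : ℂ) ≠ 0 := by exact_mod_cast (by positivity : (n + 1 : ℝ) ≠ 0)
  have h2 : ((n + 2 : ℝ) : ℂ) ≠ 0 := by exact_mod_cast (by positivity : (n + 2 : ℝ) ≠ 0)
  intro s
  unfold zetaIncrement
  have a (c : ℂ) (hc : c ≠ 0) : DifferentiableAt ℂ (fun s : ℂ => c ^ (-s)) s :=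
    (differentiableAt_id.neg).const_cpow (Or.inl hc)
  have b (c : ℂ) (hc : c ≠ 0) : DifferentiableAt ℂ (fun s : ℂ => c ^ (1 - s)) s :=
    (differentiableAt_id.const_sub 1).const_cpow (Or.inl hc)
  exact (((differentiableAt_id.sub_const 1).mul (a _ h2)).add (b _ h2)).sub (b _ h1)

lemma summable_zetaIncrement {s : ℂ} (hs : 0 < s.re) : Summable fun n => zetaIncrement n s :=
  .of_norm_bounded ((summable_add_one_rpow hs).mul_left _) (norm_zetaIncrement_le hs)

lemma differentiableOn_tsum_zetaIncrement :
    DifferentiableOn ℂ (fun s => ∑' n, zetaIncrement n s) {s | 0 < s.re} := by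
  intro s hs
  have hs : 0 < s.re := hs
  -- The half-plane fixes a summable exponent, and the ball bounds the factors ‖z - 1‖ ‖z‖.
  set U : Set ℂ := {z | s.re / 2 < z.re} ∩ Metric.ball 0 (‖s‖ + 1)
  have hU : IsOpen U := (isOpen_lt continuous_const Complex.continuous_re).inter Metric.isOpen_ball
  have hsU : s ∈ U := ⟨by simp only [mem_ofPred_eq]; linarith, by simp⟩
  refine ((Complex.differentiableOn_tsum_of_summable_norm
    (u := fun n : ℕ => (‖s‖ + 2) * (‖s‖ + 1) * ((n : ℝ) + 1) ^ (-(s.re / 2) - 1))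
    ((summable_add_one_rpow (half_pos hs)).mul_left _)
    (fun n => (differentiable_zetaIncrement n).differentiableOn) hU ?_).differentiableAt
    (hU.mem_nhds hsU)).differentiableWithinAt
  rintro n z ⟨hz1, hz2⟩
  have hz1 : s.re / 2 < z.re := hz1
  have hz2 : ‖z‖ ≤ ‖s‖ + 1 := by simpa using (mem_ball_zero_iff.1 hz2).le
  refine (norm_zetaIncrement_le (by linarith) n).trans ?_
  have : ‖z - 1‖ ≤ ‖s‖ + 2 := (norm_sub_le _ _).trans (by rw [norm_one]; linarith)
  gcongr
  · simp

/-- `∑ k ≤ N, k ^ (-s) - N ^ (1 - s) / (1 - s)`. -/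
noncomputable def zetaApprox (N : ℕ) (s : ℂ) : ℂ :=
  ∑ n ∈ Finset.range N, ((n + 1 : ℝ) : ℂ) ^ (-s) - (N : ℂ) ^ (1 - s) / (1 - s)

lemma zetaApprox_add_one {s : ℂ} (hs : s ≠ 1) (N : ℕ) :
    zetaApprox (N + 1) s
      = 1 - 1 / (1 - s) + (∑ n ∈ Finset.range N, zetaIncrement n s) / (s - 1) := by
  have h1 : 1 - s ≠ 0 := sub_ne_zero.2 hs.symm
  have h2 : s - 1 ≠ 0 := sub_ne_zero.2 hs
  induction N with
  | zero => simp [zetaApprox]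
  | succ N ih =>
    have : zetaApprox (N + 1 + 1) s = zetaApprox (N + 1) s + zetaIncrement N s / (s - 1) := by
      rw [zetaApprox, zetaApprox, Finset.sum_range_succ _ (N + 1), zetaIncrement,
        show (((N + 1 : ℕ) + 1 : ℝ) : ℂ) = ((N + 2 : ℝ) : ℂ) by push_cast; ring,
        show ((N + 1 + 1 : ℕ) : ℂ) = ((N + 2 : ℝ) : ℂ) by push_cast; ring,
        show ((N + 1 : ℕ) : ℂ) = ((N + 1 : ℝ) : ℂ) by push_cast; ring]
      field_simp
      rw [show (s - 1) = -(1 - s) by ring]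
      field_simp
      ring
    rw [this, ih, Finset.sum_range_succ]
    ring

lemma tendsto_zetaApprox_of_one_lt {s : ℂ} (hs : 1 < s.re) :
    Tendsto (fun N => zetaApprox N s) atTop (𝓝 (riemannZeta s)) := by
  have h : Tendsto (fun N : ℕ => (N : ℂ) ^ (1 - s)) atTop (𝓝 0) := by
    rw [tendsto_zero_iff_norm_tendsto_zero]
    have := (tendsto_rpow_neg_atTop (sub_pos.2 hs)).comp (tendsto_natCast_atTop_atTop (R := ℝ))
    refine this.congr' ?_
    filter_upwards [eventually_gt_atTop 0] with N hN
    rw [Complex.norm_natCast_cpow_of_pos hN]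
    simp
  have hsum : HasSum (fun n : ℕ => ((n + 1 : ℝ) : ℂ) ^ (-s)) (riemannZeta s) := by
    rw [zeta_eq_tsum_one_div_nat_add_one_cpow hs]
    have := (summable_nat_add_iff 1).2 (Complex.summable_one_div_nat_cpow.2 hs)
    simpa [Complex.cpow_neg _ s] using this.hasSum
  simpa [zetaApprox] using hsum.tendsto_sum_nat.sub (h.div_const (1 - s))

/-- Multiplying by s - 1 removes the pole, so both sides become analytic on the connected half-plane
Re s > 0. They agree for Re s > 1, where N^(1-s) tends to 0. -/
lemma riemannZeta_eq_tsum_zetaIncrement {s : ℂ} (hs : 0 < s.re) (hs1 : s ≠ 1) :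
    riemannZeta s = 1 - 1 / (1 - s) + (∑' n, zetaIncrement n s) / (s - 1) := by
  have hU : IsOpen {s : ℂ | 0 < s.re} := isOpen_lt continuous_const Complex.continuous_re
  have hlim {s : ℂ} (hs : 0 < s.re) (hs1 : s ≠ 1) : Tendsto (fun N => zetaApprox N s) atTop
      (𝓝 (1 - 1 / (1 - s) + (∑' n, zetaIncrement n s) / (s - 1))) := by
    rw [← tendsto_add_atTop_iff_nat 1]
    simp_rw [zetaApprox_add_one hs1]
    exact ((summable_zetaIncrement hs).hasSum.tendsto_sum_nat.div_const _).const_add _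
  have key : EqOn (fun s => s + ∑' n, zetaIncrement n s) riemannZeta₁ {s : ℂ | 0 < s.re} := by
    refine AnalyticOnNhd.eqOn_of_preconnected_of_eventuallyEq (z₀ := 2)
      ((differentiableOn_id.add differentiableOn_tsum_zetaIncrement).analyticOnNhd hU)
      (differentiable_riemannZeta₁.differentiableOn.analyticOnNhd hU)
      (convex_halfSpace_re_gt 0).isPreconnected (by simp) ?_
    have : {s : ℂ | 1 < s.re} ∈ 𝓝 (2 : ℂ) :=
      (isOpen_lt continuous_const Complex.continuous_re).mem_nhds (by simp)
    filter_upwards [this] with s hs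
    have hs : 1 < s.re := hs
    have hs1 : s ≠ 1 := by rintro rfl; simp at hs
    have h := tendsto_nhds_unique (tendsto_zetaApprox_of_one_lt hs) (hlim (by linarith) hs1)
    rw [riemannZeta_eq_inv_sub_mul hs1] at h
    have h2 : s - 1 ≠ 0 := sub_ne_zero.2 hs1
    rw [show (1 - s) = -(s - 1) by ring] at h
    field_simp at h
    rw [h]
    ring
  rw [riemannZeta_eq_inv_sub_mul hs1, ← key hs]
  have h2 : s - 1 ≠ 0 := sub_ne_zero.2 hs1
  rw [show (1 - s) = -(s - 1) by ring]
  field_simp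
  ring

lemma tendsto_zetaApprox {s : ℂ} (hs : 0 < s.re) (hs1 : s ≠ 1) :
    Tendsto (fun N => zetaApprox N s) atTop (𝓝 (riemannZeta s)) := by
  rw [← tendsto_add_atTop_iff_nat 1, riemannZeta_eq_tsum_zetaIncrement hs hs1]
  simp_rw [zetaApprox_add_one hs1]
  exact ((summable_zetaIncrement hs).hasSum.tendsto_sum_nat.div_const _).const_add _

/-! ### Growth and integrability on the critical line -/

lemma exists_norm_zetaApprox_critical_line_le :
    ∃ K : ℝ, 0 ≤ K ∧ ∀ (N : ℕ) (v : ℝ),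
      ‖zetaApprox N (1 / 2 + Complex.I * v)‖ ≤ K * (1 + |v|) := by
  set T := ∑' n : ℕ, ((n : ℝ) + 1) ^ (-(1 / 2) - 1 : ℝ)
  have hT : 0 ≤ T := tsum_nonneg fun n => by positivity
  refine ⟨3 + T, by positivity, fun N v => ?_⟩
  set s : ℂ := 1 / 2 + Complex.I * v
  have hre : s.re = 1 / 2 := by simp [s]
  have hs1 : s ≠ 1 := fun h => by rw [h] at hre; norm_num at hre
  -- The telescoped formula starts at N + 1; for N = 0 the approximant is 0, because `0 ^ (1 - s) =
  -- 0`.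
  rcases N with _ | N
  · have : (1 - s) ≠ 0 := sub_ne_zero.2 hs1.symm
    simp only [zetaApprox, Finset.range_zero, Finset.sum_empty, Nat.cast_zero,
      Complex.zero_cpow this, zero_div, sub_zero, norm_zero]
    positivity
  have hpos : 0 < ‖s - 1‖ := norm_pos_iff.2 (sub_ne_zero.2 hs1)
  have hhalf : 1 / 2 ≤ ‖1 - s‖ := by
    refine le_trans ?_ (Complex.abs_re_le_norm _)
    rw [Complex.sub_re, hre]
    norm_num
  have hs : ‖s‖ ≤ 1 + |v| := by
    refine (norm_add_le _ _).trans ?_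
    simp only [norm_mul, Complex.norm_I, Complex.norm_real, Real.norm_eq_abs, one_mul]
    norm_num
  have hsum : ‖(∑ n ∈ Finset.range N, zetaIncrement n s) / (s - 1)‖ ≤ ‖s‖ * T := by
    rw [norm_div, div_le_iff₀ hpos]
    calc _ ≤ ∑ n ∈ Finset.range N, ‖s - 1‖ * ‖s‖ * ((n : ℝ) + 1) ^ (-s.re - 1) :=
          norm_sum_le_of_le _ fun n _ => norm_zetaIncrement_le (by rw [hre]; norm_num) n
      _ ≤ ‖s - 1‖ * ‖s‖ * T := by
          rw [← Finset.mul_sum, hre]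
          gcongr
          exact (summable_add_one_rpow (by norm_num)).sum_le_tsum _ fun n _ => by positivity
      _ = _ := by ring
  have h3 : ‖(1 : ℂ) - 1 / (1 - s)‖ ≤ 3 := by
    refine (norm_sub_le _ _).trans ?_
    rw [norm_div, norm_one]
    have : 1 / ‖1 - s‖ ≤ 1 / (1 / 2) := one_div_le_one_div_of_le (by norm_num) hhalf
    linarith
  rw [zetaApprox_add_one hs1]
  refine (norm_add_le _ _).trans ((add_le_add h3 hsum).trans ?_)
  nlinarith [abs_nonneg v]

lemma exists_norm_riemannZeta_critical_line_le :
    ∃ K : ℝ, 0 ≤ K ∧ ∀ v : ℝ, ‖riemannZeta (1 / 2 + Complex.I * v)‖ ≤ K * (1 + |v|) := by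
  obtain ⟨K, hK, h⟩ := exists_norm_zetaApprox_critical_line_le
  refine ⟨K, hK, fun v => le_of_tendsto
    (tendsto_zetaApprox (s := 1 / 2 + Complex.I * v) (by simp) fun hs => ?_).norm
    (Eventually.of_forall fun N => h N v)⟩
  have := congrArg Complex.re hs
  norm_num at this

lemma norm_Gamma_critical_line_sq (v : ℝ) :
    ‖Complex.Gamma (1 / 2 + Complex.I * v)‖ ^ 2 = Real.pi / Real.cosh (Real.pi * v) := by
  have h := Complex.Gamma_mul_Gamma_one_sub (1 / 2 + Complex.I * v)
  rw [show 1 - (1 / 2 + Complex.I * v) = starRingEnd ℂ (1 / 2 + Complex.I * v) by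
      simp [Complex.ext_iff]; norm_num,
    Complex.Gamma_conj, Complex.mul_conj,
    show (Real.pi : ℂ) * (1 / 2 + Complex.I * v)
      = ((Real.pi * v : ℝ) : ℂ) * Complex.I + Real.pi / 2 by push_cast; ring,
    Complex.sin_add_pi_div_two, Complex.cos_mul_I, Complex.normSq_eq_norm_sq] at h
  exact_mod_cast h

/-- Since cosh(πv) ≥ e^(2|v|)/2, the square is at most 2π e^(-2|v|), and 2π < 9. The true rate π/2
is not needed. -/
lemma norm_Gamma_critical_line_le (v : ℝ) :
    ‖Complex.Gamma (1 / 2 + Complex.I * v)‖ ≤ 3 * Real.exp (-|v|) := by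
  refine le_of_sq_le_sq ?_ (by positivity)
  rw [norm_Gamma_critical_line_sq, mul_pow, ← Real.exp_nat_mul, ← Real.cosh_abs, abs_mul,
    abs_of_pos Real.pi_pos, div_le_iff₀ (Real.cosh_pos _), Real.cosh_eq]
  have h1 : Real.exp (2 * |v|) ≤ Real.exp (Real.pi * |v|) := by
    gcongr
    linarith [Real.pi_gt_three]
  have h2 : Real.exp ((2 : ℕ) * -|v|) * Real.exp (2 * |v|) = 1 := by
    rw [← Real.exp_add]; simp
  have h3 := Real.exp_pos ((2 : ℕ) * -|v|)
  have h4 := mul_pos h3 (Real.exp_pos (-(Real.pi * |v|)))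
  have h5 := Real.pi_lt_four
  have h6 := h2.symm.trans_le (mul_le_mul_of_nonneg_left h1 h3.le)
  generalize Real.exp ((2 : ℕ) * -|v|) = E at *
  linarith

lemma integrable_sq_mul_exp_neg_abs :
    Integrable fun v : ℝ => (1 + |v|) ^ 2 * Real.exp (-|v|) := by
  -- The constant comes from (1 + |v|)^4 ≤ 4! e^(1 + |v|).
  refine (integrable_inv_one_add_sq.const_mul (24 * Real.exp 1)).mono'
    (by fun_prop) (Eventually.of_forall fun v => ?_)
  rw [Real.norm_of_nonneg (by positivity)]
  have h := Real.pow_div_factorial_le_exp (1 + |v|) (by positivity) 4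
  rw [Real.exp_add, div_le_iff₀ (by positivity)] at h
  norm_num [Nat.factorial] at h
  have h0 : 0 < 1 + v ^ 2 := by positivity
  rw [Real.exp_neg, ← div_eq_mul_inv, ← div_eq_mul_inv, div_le_div_iff₀ (Real.exp_pos _) h0]
  have h1 : 1 + v ^ 2 ≤ (1 + |v|) ^ 2 := by nlinarith [sq_abs v, abs_nonneg v]
  calc (1 + |v|) ^ 2 * (1 + v ^ 2) ≤ (1 + |v|) ^ 2 * (1 + |v|) ^ 2 := by gcongr
    _ ≤ _ := by linarith

lemma critical_line_ne_one (v : ℝ) : (1 / 2 + Complex.I * v : ℂ) ≠ 1 := fun hs => by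
  have := congrArg Complex.re hs
  norm_num at this

lemma continuous_riemannZeta_critical_line :
    Continuous fun v : ℝ => riemannZeta (1 / 2 + Complex.I * v) :=
  continuous_iff_continuousAt.2 fun v =>
    ContinuousAt.comp (f := fun v : ℝ => (1 / 2 + Complex.I * v : ℂ))
      (differentiableAt_riemannZeta (critical_line_ne_one v)).continuousAt
      (by fun_prop)

lemma continuous_Gamma_critical_line :
    Continuous fun v : ℝ => Complex.Gamma (1 / 2 + Complex.I * v) :=
  continuous_iff_continuousAt.2 fun v =>
    ContinuousAt.comp (f := fun v : ℝ => (1 / 2 + Complex.I * v : ℂ))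
      (Complex.differentiableAt_Gamma _ fun m h => by
        have := congrArg Complex.re h
        norm_num at this
        have : (0 : ℝ) ≤ m := by positivity
        linarith).continuousAt
      (by fun_prop)

lemma exists_norm_zeta_Gamma_le : ∃ K : ℝ, 0 ≤ K ∧ ∀ v : ℝ,
    ‖riemannZeta (1 / 2 + Complex.I * v) * Complex.Gamma (1 / 2 + Complex.I * v)‖
      ≤ K * ((1 + |v|) * Real.exp (-|v|)) := by
  obtain ⟨K, hK, h⟩ := exists_norm_riemannZeta_critical_line_le
  refine ⟨K * 3, by positivity, fun v => ?_⟩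
  rw [norm_mul]
  calc _ ≤ (K * (1 + |v|)) * (3 * Real.exp (-|v|)) := by
        gcongr
        · exact h v
        · exact norm_Gamma_critical_line_le v
    _ = _ := by ring

lemma integrable_zeta_Gamma : Integrable fun v : ℝ =>
    riemannZeta (1 / 2 + Complex.I * v) * Complex.Gamma (1 / 2 + Complex.I * v) := by
  obtain ⟨K, hK, h⟩ := exists_norm_zeta_Gamma_le
  refine (integrable_sq_mul_exp_neg_abs.const_mul K).mono'
    (continuous_riemannZeta_critical_line.mul
      continuous_Gamma_critical_line).aestronglyMeasurable
    (Eventually.of_forall fun v => (h v).trans ?_)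
  gcongr
  nlinarith [abs_nonneg v]

lemma integrable_zeta_sq_Gamma : Integrable fun v : ℝ =>
    riemannZeta (1 / 2 + Complex.I * v) ^ 2 * Complex.Gamma (1 / 2 + Complex.I * v)
      * (2 : ℂ) ^ (-(Complex.I * v)) := by
  obtain ⟨K, hK, h⟩ := exists_norm_zeta_Gamma_le
  obtain ⟨K', hK', h'⟩ := exists_norm_riemannZeta_critical_line_le
  refine (integrable_sq_mul_exp_neg_abs.const_mul (K' * K)).mono'
    (((continuous_riemannZeta_critical_line.pow 2).mul
      continuous_Gamma_critical_line).mul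
      (Continuous.const_cpow (by fun_prop) (Or.inl two_ne_zero))).aestronglyMeasurable
    (Eventually.of_forall fun v => ?_)
  have h2 : ‖(2 : ℂ) ^ (-(Complex.I * v))‖ = 1 := by
    have := Complex.norm_cpow_eq_rpow_re_of_pos (x := 2) two_pos (-(Complex.I * v))
    simpa using this
  rw [norm_mul, h2, mul_one, pow_two, mul_assoc, norm_mul]
  calc _ ≤ (K' * (1 + |v|)) * (K * ((1 + |v|) * Real.exp (-|v|))) := by
        gcongr
        · exact h' v
        · exact h v
    _ = _ := by ring

/-! ### The kernel b and its Mellin transform -/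

/-- The function `1 / (e ^ t - 1) - 1 / t`. -/
noncomputable def boseKernel (t : ℝ) : ℝ := 1 / (Real.exp t - 1) - 1 / t

lemma exp_sub_one_pos {t : ℝ} (ht : 0 < t) : 0 < Real.exp t - 1 := by
  linarith [Real.add_one_lt_exp ht.ne']

lemma boseKernel_nonpos {t : ℝ} (ht : 0 < t) : boseKernel t ≤ 0 :=
  sub_nonpos.2 (one_div_le_one_div_of_le ht (by linarith [Real.add_one_le_exp t]))

lemma abs_boseKernel_le_one_div {t : ℝ} (ht : 0 < t) : |boseKernel t| ≤ 1 / t := by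
  rw [abs_of_nonpos (boseKernel_nonpos ht), boseKernel]
  have := exp_sub_one_pos ht
  have : 0 ≤ 1 / (Real.exp t - 1) := by positivity
  linarith

lemma abs_boseKernel_le_one {t : ℝ} (ht : 0 < t) : |boseKernel t| ≤ 1 := by
  rw [abs_of_nonpos (boseKernel_nonpos ht), boseKernel, neg_sub]
  have h := exp_sub_one_pos ht
  rw [div_sub_div _ _ ht.ne' h.ne', div_le_one (mul_pos ht h)]
  have h1 := Real.add_one_le_exp (-t)
  have h2 : Real.exp t * Real.exp (-t) = 1 := by rw [← Real.exp_add]; simp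
  nlinarith [mul_le_mul_of_nonneg_left h1 (Real.exp_pos t).le]

lemma continuousOn_boseKernel : ContinuousOn boseKernel (Ioi 0) := by
  unfold boseKernel
  exact ContinuousOn.sub
    (ContinuousOn.div (by fun_prop) (by fun_prop) fun t ht => (exp_sub_one_pos ht).ne')
    (ContinuousOn.div (by fun_prop) (by fun_prop) fun t ht => (mem_Ioi.1 ht).ne')

/-- The factor 1 - e^(-Nt) truncates the geometric series of 1/(e^t - 1); the damped 1/t becomes the
source of the correction N^(1-s)/(1-s). -/
lemma one_sub_exp_mul_boseKernel {t : ℝ} (ht : 0 < t) (N : ℕ) :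
    (1 - Real.exp (-(N * t))) * boseKernel t
      = ∑ n ∈ Finset.range N, Real.exp (-((n + 1) * t)) - (1 - Real.exp (-(N * t))) / t := by
  have h := exp_sub_one_pos ht
  have hsum : ∑ n ∈ Finset.range N, Real.exp (-((n + 1) * t))
      = (1 - Real.exp (-(N * t))) / (Real.exp t - 1) := by
    induction N with
    | zero => simp
    | succ N ih =>
      rw [Finset.sum_range_succ, ih, div_add' _ _ _ h.ne', mul_sub, ← Real.exp_add]
      push_cast
      ring_nf
  rw [hsum, boseKernel]
  ring

lemma mellinConvergent_of_bounded_of_le_one_div {f : ℝ → ℝ} (hc : ContinuousOn f (Ioi 0)) {C D : ℝ}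
    (h0 : ∀ t, 0 < t → |f t| ≤ C) (h1 : ∀ t, 0 < t → |f t| ≤ D / t)
    {s : ℂ} (hs : 0 < s.re) (hs1 : s.re < 1) : MellinConvergent (fun t => (f t : ℂ)) s := by
  refine mellinConvergent_of_isBigO_rpow (a := 1) (b := 0)
    ((Complex.continuous_ofReal.comp_continuousOn hc).locallyIntegrableOn measurableSet_Ioi)
    ?_ hs1 ?_ hs
  · refine Asymptotics.IsBigO.of_bound D ?_
    filter_upwards [eventually_gt_atTop 0] with t ht
    simpa [Real.rpow_neg_one, abs_of_pos ht, div_eq_mul_inv] using h1 t ht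
  · refine Asymptotics.IsBigO.of_bound C ?_
    filter_upwards [self_mem_nhdsWithin] with t ht
    simpa using h0 t ht

lemma hasMellin_exp_neg_mul {s : ℂ} (hs : 0 < s.re) {r : ℝ} (hr : 0 < r) :
    HasMellin (fun t : ℝ => ((Real.exp (-(r * t)) : ℝ) : ℂ)) s
      ((r : ℂ) ^ (-s) * Complex.Gamma s) := by
  constructor
  · refine mellinConvergent_of_isBigO_rpow_exp (a := r) (b := 0) hr
      (ContinuousOn.locallyIntegrableOn (by fun_prop) measurableSet_Ioi) ?_ ?_ hs
    · refine Asymptotics.IsBigO.of_bound 1 (Eventually.of_forall fun t => ?_)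
      simp [Complex.norm_exp]
    · refine Asymptotics.IsBigO.of_bound 1 ?_
      filter_upwards [self_mem_nhdsWithin] with t ht
      have ht : 0 < t := ht
      simp only [Complex.norm_real, Real.norm_eq_abs, Real.abs_exp, neg_zero, Real.rpow_zero,
        abs_one, mul_one, Real.exp_le_one_iff]
      simp only [Left.neg_nonpos_iff]
      positivity
  · have := Complex.integral_cpow_mul_exp_neg_mul_Ioi hs hr
    rw [one_div, Complex.inv_cpow _ _ (by
      rw [Complex.arg_ofReal_of_nonneg hr.le]; exact Real.pi_pos.ne), ← Complex.cpow_neg] at this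
    rw [← this, mellin]
    simp

lemma abs_one_sub_exp_neg_le {r t : ℝ} (hr : 0 < r) (ht : 0 < t) :
    |1 - Real.exp (-(r * t))| ≤ r * t ∧ |1 - Real.exp (-(r * t))| ≤ 1 := by
  have h1 := Real.add_one_le_exp (-(r * t))
  have h2 := Real.exp_pos (-(r * t))
  have h3 : Real.exp (-(r * t)) ≤ 1 := by
    rw [Real.exp_le_one_iff, neg_nonpos]; positivity
  rw [abs_of_nonneg (by linarith)]
  constructor <;> linarith

/-- Neither 1/t nor e^(-rt)/t alone is Mellin-integrable at 0 in the strip, so the difference is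
integrated by parts against t^(s-1)/(s-1). The boundary terms are O(t^σ) at 0 and O(t^(σ-1)) at
infinity. -/
lemma hasMellin_one_sub_exp_div {s : ℂ} (hs : 0 < s.re) (hs1 : s.re < 1) {r : ℝ} (hr : 0 < r) :
    HasMellin (fun t : ℝ => (((1 - Real.exp (-(r * t))) / t : ℝ) : ℂ)) s
      ((r : ℂ) ^ (1 - s) / (1 - s) * Complex.Gamma s) := by
  have hne : s - 1 ≠ 0 := fun h => by
    rw [sub_eq_zero.1 h] at hs1; simp at hs1
  have hne' : 1 - s ≠ 0 := fun h => hne (by rw [← neg_sub, h, neg_zero])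
  have hconv : MellinConvergent (fun t : ℝ => (((1 - Real.exp (-(r * t))) / t : ℝ) : ℂ)) s := by
    refine mellinConvergent_of_bounded_of_le_one_div (C := r) (D := 1) ?_ ?_ ?_ hs hs1
    · exact ContinuousOn.div (by fun_prop) continuousOn_id fun t ht => ne_of_gt ht
    · intro t ht
      rw [abs_div, abs_of_pos ht, div_le_iff₀ ht]
      exact (abs_one_sub_exp_neg_le hr ht).1
    · intro t ht
      rw [abs_div, abs_of_pos ht]
      gcongr
      exact (abs_one_sub_exp_neg_le hr ht).2
  refine ⟨hconv, ?_⟩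
  obtain ⟨econv, eint⟩ := hasMellin_exp_neg_mul hs hr
  set u : ℝ → ℂ := fun t => ((1 - Real.exp (-(r * t)) : ℝ) : ℂ)
  set u' : ℝ → ℂ := fun t => ((r * Real.exp (-(r * t)) : ℝ) : ℂ)
  set v : ℝ → ℂ := fun t => (t : ℂ) ^ (s - 1) / (s - 1)
  set v' : ℝ → ℂ := fun t => (t : ℂ) ^ (s - 1 - 1)
  have huv' : EqOn (fun t : ℝ => (t : ℂ) ^ (s - 1) • (((1 - Real.exp (-(r * t))) / t : ℝ) : ℂ))
      (u * v') (Ioi 0) := by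
    intro t ht
    have ht0 : (t : ℂ) ≠ 0 := by exact_mod_cast (ne_of_gt ht)
    simp only [Pi.mul_apply, u, v', smul_eq_mul]
    rw [Complex.cpow_sub (s - 1) 1 ht0, Complex.cpow_one]
    push_cast
    ring
  have hu'v : EqOn (fun t : ℝ => (r / (s - 1)) * ((t : ℂ) ^ (s - 1) •
      ((Real.exp (-(r * t)) : ℝ) : ℂ))) (u' * v) (Ioi 0) := by
    intro t ht
    simp only [Pi.mul_apply, u', v, smul_eq_mul]
    push_cast
    ring
  have nuv (t : ℝ) (ht : 0 < t) : ‖(u * v) t‖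
      = |1 - Real.exp (-(r * t))| * (t ^ (s.re - 1) / ‖s - 1‖) := by
    simp only [Pi.mul_apply, u, v, norm_mul, norm_div, Complex.norm_real, Real.norm_eq_abs]
    rw [Complex.norm_cpow_eq_rpow_re_of_pos ht]
    simp
  have key := integral_Ioi_mul_deriv_eq_deriv_mul (a := (0 : ℝ)) (a' := (0 : ℂ)) (b' := (0 : ℂ))
    (u := u) (v := v) (u' := u') (v' := v')
    (fun t ht => by
      have h := ((hasDerivAt_id t).const_mul r).neg.exp.const_sub 1
      exact (h.congr_deriv (by simp [mul_comm])).ofReal_comp)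
    (fun t ht => by
      refine ((hasDerivAt_ofReal_cpow_of_pos ht (s - 1)).div_const (s - 1)).congr_deriv ?_
      exact mul_div_cancel_left₀ _ hne)
    (hconv.congr_fun huv' measurableSet_Ioi)
    (IntegrableOn.congr_fun (Integrable.const_mul econv _) hu'v measurableSet_Ioi)
    (by
      rw [tendsto_zero_iff_norm_tendsto_zero]
      have hlim : Tendsto (fun t : ℝ => r / ‖s - 1‖ * t ^ s.re) (𝓝[>] 0) (𝓝 0) := by
        have := (Real.continuousAt_rpow_const 0 s.re (Or.inr hs.le)).tendsto
        rw [Real.zero_rpow hs.ne'] at this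
        simpa using (this.mono_left nhdsWithin_le_nhds).const_mul (r / ‖s - 1‖)
      refine squeeze_zero' (Eventually.of_forall fun t => norm_nonneg _) ?_ hlim
      filter_upwards [self_mem_nhdsWithin] with t ht
      have ht : 0 < t := ht
      rw [nuv t ht, Real.rpow_sub_one ht.ne']
      calc _ ≤ (r * t) * (t ^ s.re / t / ‖s - 1‖) := by
            gcongr
            exact (abs_one_sub_exp_neg_le hr ht).1
        _ = _ := by field_simp)
    (by
      rw [tendsto_zero_iff_norm_tendsto_zero]
      have hlim : Tendsto (fun t : ℝ => 1 * (t ^ (s.re - 1) / ‖s - 1‖)) atTop (𝓝 0) := by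
        have := tendsto_rpow_neg_atTop (sub_pos.2 hs1)
        simpa using (this.div_const ‖s - 1‖)
      refine squeeze_zero' (Eventually.of_forall fun t => norm_nonneg _) ?_ hlim
      filter_upwards [eventually_gt_atTop 0] with t ht
      rw [nuv t ht]
      gcongr
      exact (abs_one_sub_exp_neg_le hr ht).2)
  rw [mellin, setIntegral_congr_fun measurableSet_Ioi huv']
  refine key.trans ?_
  have h2 : ∫ t in Ioi (0 : ℝ), u' t * v t = (r / (s - 1)) * ((r : ℂ) ^ (-s) * Complex.Gamma s) := by
    rw [← eint, mellin, ← integral_const_mul]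
    exact (setIntegral_congr_fun measurableSet_Ioi hu'v).symm
  have hr0 : (r : ℂ) ≠ 0 := by exact_mod_cast hr.ne'
  rw [h2, Complex.cpow_sub _ _ hr0, Complex.cpow_neg, Complex.cpow_one,
    show s - 1 = -(1 - s) by ring]
  field_simp
  ring

lemma mellin_one_sub_exp_mul_boseKernel {s : ℂ} (hs : 0 < s.re) (hs1 : s.re < 1) (N : ℕ) :
    mellin (fun t => (((1 - Real.exp (-(N * t))) * boseKernel t : ℝ) : ℂ)) s
      = zetaApprox N s * Complex.Gamma s := by
  have hne : 1 - s ≠ 0 := fun h => by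
    rw [← sub_eq_zero.1 h] at hs1; simp at hs1
  rcases N.eq_zero_or_pos with rfl | hN
  · simp [mellin, zetaApprox, hne]
  have hN' : (0 : ℝ) < N := by exact_mod_cast hN
  have hsum : HasMellin (fun t => ∑ n ∈ Finset.range N, ((Real.exp (-((n + 1) * t)) : ℝ) : ℂ)) s
      (∑ n ∈ Finset.range N, ((n + 1 : ℝ) : ℂ) ^ (-s) * Complex.Gamma s) := by
    have h (n : ℕ) := hasMellin_exp_neg_mul hs (r := n + 1) (by positivity)
    constructor
    · simp only [MellinConvergent, Finset.smul_sum]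
      exact integrable_finsetSum _ fun n _ => (h n).1
    · simp only [mellin, Finset.smul_sum]
      rw [integral_finsetSum _ fun n _ => (h n).1]
      exact Finset.sum_congr rfl fun n _ => (h n).2
  have h1 := hasMellin_one_sub_exp_div hs hs1 hN'
  have h2 := (hasMellin_sub hsum.1 h1.1).2
  rw [hsum.2, h1.2] at h2
  rw [zetaApprox, sub_mul, Finset.sum_mul]
  refine Eq.trans ?_ h2
  refine setIntegral_congr_fun measurableSet_Ioi fun t ht => ?_
  simp only
  rw [one_sub_exp_mul_boseKernel ht]
  push_cast
  rfl

lemma mellinConvergent_boseKernel {s : ℂ} (hs : 0 < s.re) (hs1 : s.re < 1) :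
    MellinConvergent (fun t => (boseKernel t : ℂ)) s :=
  mellinConvergent_of_bounded_of_le_one_div continuousOn_boseKernel
    (fun _ => abs_boseKernel_le_one) (fun _ => abs_boseKernel_le_one_div) hs hs1

/-- The damping factor lies in [0, 1] and tends to 1, so the identity for Z_N passes to the limit by
dominated convergence. -/
lemma mellin_boseKernel {s : ℂ} (hs : 0 < s.re) (hs1 : s.re < 1) :
    mellin (fun t => (boseKernel t : ℂ)) s = riemannZeta s * Complex.Gamma s := by
  have hne : s ≠ 1 := fun h => by rw [h] at hs1; simp at hs1
  refine tendsto_nhds_unique ?_ ((tendsto_zetaApprox hs hne).mul_const (Complex.Gamma s))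
  simp_rw [← mellin_one_sub_exp_mul_boseKernel hs hs1]
  have hconv := mellinConvergent_boseKernel hs hs1
  have hform (N : ℕ) (t : ℝ) : (t : ℂ) ^ (s - 1) •
      (((1 - Real.exp (-(N * t))) * boseKernel t : ℝ) : ℂ)
      = ((1 - Real.exp (-(N * t)) : ℝ) : ℂ) * ((t : ℂ) ^ (s - 1) • (boseKernel t : ℂ)) := by
    simp only [smul_eq_mul]
    push_cast
    ring
  simp only [mellin, hform]
  refine tendsto_integral_of_dominated_convergence
    (fun t => ‖(t : ℂ) ^ (s - 1) • (boseKernel t : ℂ)‖) (fun N => ?_) hconv.norm (fun N => ?_) ?_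
  · exact Continuous.aestronglyMeasurable (by fun_prop) |>.mul hconv.aestronglyMeasurable
  · filter_upwards [ae_restrict_mem measurableSet_Ioi] with t ht
    rw [norm_mul, Complex.norm_real]
    refine mul_le_of_le_one_left (norm_nonneg _) ?_
    rcases N.eq_zero_or_pos with rfl | hN
    · simp
    · exact (abs_one_sub_exp_neg_le (by exact_mod_cast hN) ht).2
  · filter_upwards [ae_restrict_mem measurableSet_Ioi] with t ht
    have ht : 0 < t := ht
    have h1 : Tendsto (fun N : ℕ => Real.exp (-(N * t))) atTop (𝓝 0) :=
      Real.tendsto_exp_neg_atTop_nhds_zero.comp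
        (tendsto_natCast_atTop_atTop.atTop_mul_const ht)
    have h2 := (Complex.continuous_ofReal.tendsto _).comp (h1.const_sub 1)
    simpa using h2.mul_const ((t : ℂ) ^ (s - 1) • (boseKernel t : ℂ))

/-! ### Mellin inversion and integration against Z_N -/

/-- The product `ζ(1/2 + iv) Γ(1/2 + iv)`. -/
noncomputable def zetaGamma (v : ℝ) : ℂ :=
  riemannZeta (1 / 2 + Complex.I * v) * Complex.Gamma (1 / 2 + Complex.I * v)

lemma norm_ofReal_cpow_neg_critical_line {x : ℝ} (hx : 0 < x) (v : ℝ) :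
    ‖(x : ℂ) ^ (-(1 / 2 + Complex.I * v))‖ = x ^ (-(1 / 2) : ℝ) := by
  rw [Complex.norm_cpow_eq_rpow_re_of_pos hx]
  simp

lemma integrable_zetaGamma_mul_cpow {x : ℝ} (hx : 0 < x) :
    Integrable fun v : ℝ => zetaGamma v * (x : ℂ) ^ (-(1 / 2 + Complex.I * v)) := by
  refine Integrable.mul_bdd (c := x ^ (-(1 / 2) : ℝ)) integrable_zeta_Gamma
    (Continuous.aestronglyMeasurable ?_)
    (Eventually.of_forall fun v => (norm_ofReal_cpow_neg_critical_line hx v).le)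
  exact Continuous.const_cpow (by fun_prop) (Or.inl (by exact_mod_cast hx.ne'))

lemma integral_zetaGamma_mul_cpow {x : ℝ} (hx : 0 < x) :
    ∫ v : ℝ, zetaGamma v * (x : ℂ) ^ (-(1 / 2 + Complex.I * v))
      = ((2 * Real.pi * boseKernel x : ℝ) : ℂ) := by
  have hσ (y : ℝ) : (((1 / 2 : ℝ) : ℂ) + y * Complex.I) = 1 / 2 + Complex.I * y := by
    push_cast; ring
  have hm (y : ℝ) : mellin (fun t => (boseKernel t : ℂ)) (((1 / 2 : ℝ) : ℂ) + y * Complex.I)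
      = zetaGamma y := by
    rw [mellin_boseKernel (by simp) (by norm_num), hσ, zetaGamma]
  have h := mellinInv_mellin_eq (1 / 2) (fun t => (boseKernel t : ℂ)) hx
    (mellinConvergent_boseKernel (by simp) (by norm_num))
    (by
      simp only [Complex.VerticalIntegrable, hm]
      exact integrable_zeta_Gamma)
    (Complex.continuous_ofReal.continuousAt.comp
      (continuousOn_boseKernel.continuousAt (Ioi_mem_nhds hx)))
  simp only [mellinInv, hm] at h
  simp only [hσ, smul_eq_mul] at h
  have hpi : (Real.pi : ℂ) ≠ 0 := by exact_mod_cast Real.pi_ne_zero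
  rw [Complex.ofReal_mul, ← h, Complex.real_smul]
  push_cast
  rw [← mul_assoc, mul_one_div_cancel (mul_ne_zero two_ne_zero hpi), one_mul]
  exact integral_congr_ae (Eventually.of_forall fun v => mul_comm _ _)

lemma two_mul_cpow_neg {x : ℝ} (hx : 0 ≤ x) (s : ℂ) :
    ((2 * x : ℝ) : ℂ) ^ (-s) = (2 : ℂ) ^ (-s) * (x : ℂ) ^ (-s) := by
  rw [Complex.ofReal_mul, Complex.mul_cpow_ofReal_nonneg zero_le_two hx]
  simp

lemma integral_cpow_neg_critical_line {X : ℝ} (v : ℝ) :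
    ∫ x in (0 : ℝ)..X, (x : ℂ) ^ (-(1 / 2 + Complex.I * v))
      = (X : ℂ) ^ (1 - (1 / 2 + Complex.I * v)) / (1 - (1 / 2 + Complex.I * v)) := by
  have hne : 1 - (1 / 2 + Complex.I * v) ≠ 0 := sub_ne_zero.2 (critical_line_ne_one v).symm
  rw [integral_cpow (Or.inl (by simp; norm_num)), show -(1 / 2 + Complex.I * v) + 1
    = 1 - (1 / 2 + Complex.I * (v : ℂ)) by ring, Complex.ofReal_zero, Complex.zero_cpow hne,
    sub_zero]

/-- Fubini applies because the modulus is |ζΓ|(v) (2x)^(-1/2), a product of integrable functions on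
ℝ and on (0, X]. -/
lemma integral_zetaGamma_mul_cpow_div {X : ℝ} (hX : 0 ≤ X) :
    ∫ v : ℝ, zetaGamma v * (2 : ℂ) ^ (-(1 / 2 + Complex.I * v)) *
        ((X : ℂ) ^ (1 - (1 / 2 + Complex.I * v)) / (1 - (1 / 2 + Complex.I * v)))
      = ((2 * Real.pi * ∫ x in (0 : ℝ)..X, boseKernel (2 * x) : ℝ) : ℂ) := by
  have hint : Integrable (Function.uncurry fun (v x : ℝ) =>
      zetaGamma v * ((2 * x : ℝ) : ℂ) ^ (-(1 / 2 + Complex.I * v)))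
      (volume.prod (volume.restrict (Ioc 0 X))) := by
    have hb : Integrable (fun x : ℝ => (2 * x) ^ (-(1 / 2) : ℝ)) (volume.restrict (Ioc 0 X)) := by
      have := (intervalIntegral.intervalIntegrable_rpow' (a := 0) (b := X)
        (r := -(1 / 2)) (by norm_num)).1
      refine IntegrableOn.congr_fun (Integrable.const_mul this ((2 : ℝ) ^ (-(1 / 2) : ℝ)))
        (fun x hx => ?_) measurableSet_Ioc
      exact (Real.mul_rpow zero_le_two hx.1.le).symm
    refine (Integrable.mul_prod integrable_zeta_Gamma.norm hb).mono' ?_ ?_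
    · refine (integrable_zeta_Gamma.aestronglyMeasurable.comp_fst).mul
        (Measurable.aestronglyMeasurable ?_)
      exact Measurable.pow (by fun_prop) (by fun_prop)
    · have hmem : ∀ᵐ p : ℝ × ℝ ∂volume.prod (volume.restrict (Ioc 0 X)), p.2 ∈ Ioc 0 X :=
        Measure.quasiMeasurePreserving_snd.ae (ae_restrict_mem measurableSet_Ioc)
      filter_upwards [hmem] with p hp
      simp only [Function.uncurry, norm_mul]
      rw [norm_ofReal_cpow_neg_critical_line (by linarith [hp.1])]
      simp [zetaGamma]
  have hswap := integral_integral_swap hint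
  calc _ = ∫ v : ℝ, ∫ x in Ioc 0 X,
        zetaGamma v * ((2 * x : ℝ) : ℂ) ^ (-(1 / 2 + Complex.I * v)) := by
        refine integral_congr_ae (Eventually.of_forall fun v => ?_)
        simp only
        rw [← integral_cpow_neg_critical_line, intervalIntegral.integral_of_le hX,
          ← integral_const_mul]
        refine setIntegral_congr_fun measurableSet_Ioc fun x hx => ?_
        rw [two_mul_cpow_neg hx.1.le]
        ring
    _ = ∫ x in Ioc 0 X, ((2 * Real.pi * boseKernel (2 * x) : ℝ) : ℂ) := by
        rw [hswap]
        exact setIntegral_congr_fun measurableSet_Ioc fun x hx =>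
          integral_zetaGamma_mul_cpow (by linarith [hx.1])
    _ = _ := by
        rw [integral_complex_ofReal, integral_const_mul, intervalIntegral.integral_of_le hX]

lemma integral_zetaGamma_mul_zetaApprox (N : ℕ) :
    ∫ v : ℝ, zetaGamma v * (2 : ℂ) ^ (-(1 / 2 + Complex.I * v)) *
        zetaApprox N (1 / 2 + Complex.I * v)
      = ((2 * Real.pi * (∑ n ∈ Finset.range N, boseKernel (2 * (n + 1))
          - ∫ x in (0 : ℝ)..N, boseKernel (2 * x)) : ℝ) : ℂ) := by
  have h2 : Integrable fun v : ℝ => zetaGamma v * (2 : ℂ) ^ (-(1 / 2 + Complex.I * v)) := by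
    simpa using integrable_zetaGamma_mul_cpow two_pos
  have hterm (n : ℕ) (v : ℝ) : zetaGamma v * (2 : ℂ) ^ (-(1 / 2 + Complex.I * v)) *
        ((n + 1 : ℝ) : ℂ) ^ (-(1 / 2 + Complex.I * v))
      = zetaGamma v * ((2 * (n + 1) : ℝ) : ℂ) ^ (-(1 / 2 + Complex.I * v)) := by
    rw [two_mul_cpow_neg (by positivity), mul_assoc]
  have hi1 (n : ℕ) : Integrable fun v : ℝ => zetaGamma v *
      ((2 * (n + 1) : ℝ) : ℂ) ^ (-(1 / 2 + Complex.I * v)) :=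
    integrable_zetaGamma_mul_cpow (by positivity)
  have hi2 : Integrable fun v : ℝ => zetaGamma v * (2 : ℂ) ^ (-(1 / 2 + Complex.I * v)) *
      (((N : ℝ) : ℂ) ^ (1 - (1 / 2 + Complex.I * v)) / (1 - (1 / 2 + Complex.I * v))) := by
    have hne (v : ℝ) : 1 - (1 / 2 + Complex.I * v) ≠ 0 :=
      sub_ne_zero.2 (critical_line_ne_one v).symm
    have hre (v : ℝ) : (1 - (1 / 2 + Complex.I * v)).re = 1 / 2 := by simp; norm_num
    refine Integrable.mul_bdd (c := (N : ℝ) ^ (1 / 2 : ℝ) / (1 / 2)) h2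
      (Continuous.aestronglyMeasurable ?_) (Eventually.of_forall fun v => ?_)
    · refine Continuous.div ?_ (by fun_prop) hne
      -- Continuity of the power in its exponent needs a nonzero base; for N = 0 the power is
      -- constantly 0.
      rcases N.eq_zero_or_pos with rfl | hN
      · simp only [Nat.cast_zero, Complex.ofReal_zero, Complex.zero_cpow (hne _)]
        exact continuous_const
      · exact Continuous.const_cpow (by fun_prop) (Or.inl (by simpa using hN.ne'))
    · rw [norm_div, Complex.norm_cpow_eq_rpow_re_of_nonneg N.cast_nonneg (by rw [hre]; norm_num),
        hre]
      gcongr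
      rw [← hre v]
      exact (le_abs_self _).trans (Complex.abs_re_le_norm _)
  simp only [zetaApprox, mul_sub, Finset.mul_sum, hterm]
  rw [integral_sub (integrable_finsetSum _ fun n _ => hi1 n) (by simpa using hi2),
    integral_finsetSum _ fun n _ => hi1 n]
  have := integral_zetaGamma_mul_cpow_div (X := N) N.cast_nonneg
  simp only [Complex.ofReal_natCast] at this
  rw [this, Finset.sum_congr rfl fun n _ => integral_zetaGamma_mul_cpow (by positivity)]
  push_cast
  rfl

lemma tendsto_integral_zetaGamma_mul_zetaApprox :
    Tendsto (fun N : ℕ => ∫ v : ℝ, zetaGamma v * (2 : ℂ) ^ (-(1 / 2 + Complex.I * v)) *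
        zetaApprox N (1 / 2 + Complex.I * v)) atTop
      (𝓝 (∫ v : ℝ, zetaGamma v * (2 : ℂ) ^ (-(1 / 2 + Complex.I * v)) *
        riemannZeta (1 / 2 + Complex.I * v))) := by
  obtain ⟨K, hK, h⟩ := exists_norm_zeta_Gamma_le
  obtain ⟨K', hK', h'⟩ := exists_norm_zetaApprox_critical_line_le
  have h2 : Integrable fun v : ℝ => zetaGamma v * (2 : ℂ) ^ (-(1 / 2 + Complex.I * v)) := by
    simpa using integrable_zetaGamma_mul_cpow two_pos
  have hnorm (v : ℝ) : ‖(2 : ℂ) ^ (-(1 / 2 + Complex.I * v))‖ = 2 ^ (-(1 / 2) : ℝ) := by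
    simpa using norm_ofReal_cpow_neg_critical_line two_pos v
  have hcont (N : ℕ) : Continuous fun v : ℝ => zetaApprox N (1 / 2 + Complex.I * v) := by
    have hne (v : ℝ) : 1 - (1 / 2 + Complex.I * v) ≠ 0 :=
      sub_ne_zero.2 (critical_line_ne_one v).symm
    unfold zetaApprox
    refine Continuous.sub (continuous_finsetSum _ fun n _ => Continuous.const_cpow (by fun_prop)
      (Or.inl (by exact_mod_cast (by positivity : (n + 1 : ℝ) ≠ 0))))
      (Continuous.div ?_ (by fun_prop) hne)
    rcases N.eq_zero_or_pos with rfl | hN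
    · simp only [Nat.cast_zero, Complex.zero_cpow (hne _)]
      exact continuous_const
    · exact Continuous.const_cpow (by fun_prop) (Or.inl (by simpa using hN.ne'))
  refine tendsto_integral_of_dominated_convergence
    (fun v => K * 2 ^ (-(1 / 2) : ℝ) * K' * ((1 + |v|) ^ 2 * Real.exp (-|v|)))
    (fun N => h2.aestronglyMeasurable.mul (hcont N).aestronglyMeasurable)
    (integrable_sq_mul_exp_neg_abs.const_mul _) (fun N => Eventually.of_forall fun v => ?_)
    (Eventually.of_forall fun v =>
      (tendsto_zetaApprox (by simp) (critical_line_ne_one v)).const_mul _)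
  rw [norm_mul, norm_mul, hnorm]
  calc _ ≤ K * ((1 + |v|) * Real.exp (-|v|)) * 2 ^ (-(1 / 2) : ℝ) * (K' * (1 + |v|)) := by
        gcongr
        · exact h v
        · exact h' N v
    _ = _ := by ring

/-! ### Evaluating the limit -/

lemma hasDerivAt_log_one_sub_exp_div {t : ℝ} (ht : 0 < t) :
    HasDerivAt (fun t => Real.log ((1 - Real.exp (-t)) / t)) (boseKernel t) t := by
  have h1 : 0 < 1 - Real.exp (-t) := by
    have : Real.exp (-t) < 1 := by simpa using ht
    linarith
  have h2 := exp_sub_one_pos ht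
  have h := ((((hasDerivAt_neg t).exp.const_sub 1).div (hasDerivAt_id t) ht.ne').log
    (div_pos h1 ht).ne')
  refine h.congr_deriv ?_
  have h3 : Real.exp (-t) = 1 / Real.exp t := by rw [Real.exp_neg, one_div]
  have h4 : 1 - 1 / Real.exp t ≠ 0 := by rw [← h3]; exact h1.ne'
  simp only [boseKernel, Pi.div_apply, id, h3]
  have := Real.exp_pos t
  field_simp

/-- The quotient tends to the slope of 1 - e^(-t) at 0, so the primitive contributes nothing at the
lower endpoint. -/
lemma tendsto_log_one_sub_exp_div :
    Tendsto (fun t => Real.log ((1 - Real.exp (-t)) / t)) (𝓝[>] 0) (𝓝 0) := by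
  have h : HasDerivAt (fun t : ℝ => 1 - Real.exp (-t)) 1 0 :=
    ((hasDerivAt_neg 0).exp.const_sub 1).congr_deriv (by simp)
  have h1 := h.tendsto_slope_zero_right
  have h2 : Tendsto (fun t => (1 - Real.exp (-t)) / t) (𝓝[>] 0) (𝓝 1) := by
    simpa [div_eq_inv_mul] using h1
  simpa using h2.log one_ne_zero

lemma integral_boseKernel_two_mul {X : ℝ} (hX : 0 < X) :
    ∫ x in (0 : ℝ)..X, boseKernel (2 * x)
      = (Real.log (1 - Real.exp (-(2 * X))) - Real.log 2 - Real.log X) / 2 := by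
  have h1 : 0 < 1 - Real.exp (-(2 * X)) := by
    have : Real.exp (-(2 * X)) < 1 := by simpa using hX
    linarith
  have hint : IntervalIntegrable boseKernel volume 0 (2 * X) := by
    rw [intervalIntegrable_iff_integrableOn_Ioc_of_le (by positivity)]
    refine (integrable_const (1 : ℝ)).mono'
      ((continuousOn_boseKernel.mono Ioc_subset_Ioi_self).aestronglyMeasurable measurableSet_Ioc)
      ?_
    filter_upwards [ae_restrict_mem measurableSet_Ioc] with t ht
    exact abs_boseKernel_le_one ht.1
  have h := intervalIntegral.integral_eq_sub_of_hasDerivAt_of_tendsto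
    (by positivity : (0 : ℝ) < 2 * X) (fun t ht => hasDerivAt_log_one_sub_exp_div ht.1) hint
    tendsto_log_one_sub_exp_div
    ((hasDerivAt_log_one_sub_exp_div (by positivity)).continuousAt.tendsto.mono_left
      nhdsWithin_le_nhds)
  rw [intervalIntegral.integral_comp_mul_left _ two_ne_zero, mul_zero, h,
    Real.log_div h1.ne' (by positivity), Real.log_mul two_ne_zero hX.ne', smul_eq_mul]
  ring

lemma summable_one_div_exp_sub_one :
    Summable fun j : ℕ => 1 / (Real.exp (2 * ((j : ℝ) + 1)) - 1) := by
  refine Summable.of_nonneg_of_le (fun j => ?_) (fun j => ?_)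
    ((Real.summable_exp_neg_nat).mul_left 1)
  · have := exp_sub_one_pos (t := 2 * ((j : ℝ) + 1)) (by positivity)
    positivity
  · rw [one_mul, Real.exp_neg, ← one_div]
    refine one_div_le_one_div_of_le (Real.exp_pos _) ?_
    rw [show 2 * ((j : ℝ) + 1) = j + (j + 2) by ring, Real.exp_add]
    have h1 := Real.add_one_le_exp ((j : ℝ) + 2)
    have h2 := Real.add_one_le_exp (j : ℝ)
    have h3 : (0 : ℝ) ≤ j := j.cast_nonneg
    nlinarith

/-- The sum contributes -H_N/2 and the integral +(log 2 + log N)/2, which combine to (log 2 - γ)/2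
in the limit. -/
lemma tendsto_sum_boseKernel_sub_integral :
    Tendsto (fun N : ℕ => ∑ n ∈ Finset.range N, boseKernel (2 * (n + 1))
        - ∫ x in (0 : ℝ)..N, boseKernel (2 * x)) atTop
      (𝓝 ((2 * (∑' j : ℕ, 1 / (Real.exp (2 * ((j : ℝ) + 1)) - 1))
        - Real.eulerMascheroniConstant + Real.log 2) / 2)) := by
  have h1 := summable_one_div_exp_sub_one.hasSum.tendsto_sum_nat
  have h2 := Real.tendsto_harmonic_sub_log
  have h3 : Tendsto (fun N : ℕ => Real.log (1 - Real.exp (-(2 * N)))) atTop (𝓝 0) := by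
    have : Tendsto (fun N : ℕ => Real.exp (-(2 * N))) atTop (𝓝 0) :=
      Real.tendsto_exp_neg_atTop_nhds_zero.comp
        (tendsto_natCast_atTop_atTop.const_mul_atTop two_pos)
    simpa using (this.const_sub 1).log (by simp)
  have h := ((h1.const_mul 2).sub h2).add_const (Real.log 2) |>.sub h3 |>.div_const 2
  rw [sub_zero] at h
  refine h.congr' ?_
  filter_upwards [eventually_gt_atTop 0] with N hN
  rw [integral_boseKernel_two_mul (by exact_mod_cast hN)]
  simp only [boseKernel, Finset.sum_sub_distrib]
  have : ∑ n ∈ Finset.range N, 1 / (2 * ((n : ℝ) + 1)) = ((harmonic N : ℚ) : ℝ) / 2 := by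
    rw [harmonic, Rat.cast_sum, Finset.sum_div]
    refine Finset.sum_congr rfl fun n _ => ?_
    push_cast
    field_simp
  rw [this]
  ring

lemma integral_zeta_sq_Gamma :
    (∫ v : ℝ, riemannZeta (1 / 2 + Complex.I * v) ^ 2 * Complex.Gamma (1 / 2 + Complex.I * v)
        * (2 : ℂ) ^ (-(Complex.I * v)))
      = ((Real.sqrt 2 * Real.pi *
          (2 * (∑' j : ℕ, 1 / (Real.exp (2 * ((j : ℝ) + 1)) - 1))
            - Real.eulerMascheroniConstant + Real.log 2) : ℝ) : ℂ) := by
  have h := tendsto_integral_zetaGamma_mul_zetaApprox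
  simp_rw [integral_zetaGamma_mul_zetaApprox] at h
  have h' := tendsto_nhds_unique h ((Complex.continuous_ofReal.tendsto _).comp
    (tendsto_sum_boseKernel_sub_integral.const_mul (2 * Real.pi)))
  -- Passing from 2^(-iv) to 2^(-s) costs √2, which turns 2π · (1/2) into √2 π.
  have h2 (v : ℝ) : (2 : ℂ) ^ (-(Complex.I * v))
      = ((Real.sqrt 2 : ℝ) : ℂ) * (2 : ℂ) ^ (-(1 / 2 + Complex.I * v)) := by
    rw [Real.sqrt_eq_rpow, Complex.ofReal_cpow zero_le_two, Complex.ofReal_ofNat,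
      ← Complex.cpow_add _ _ two_ne_zero]
    congr 1
    push_cast
    ring
  calc _ = ∫ v : ℝ, ((Real.sqrt 2 : ℝ) : ℂ) * (zetaGamma v *
        (2 : ℂ) ^ (-(1 / 2 + Complex.I * v)) * riemannZeta (1 / 2 + Complex.I * v)) := by
        refine integral_congr_ae (Eventually.of_forall fun v => ?_)
        simp only
        rw [h2, zetaGamma]
        ring
    _ = _ := by
        rw [integral_const_mul, h', ← Complex.ofReal_mul]
        congr 1
        ring

/-! ### The real form -/

/-- The functional equation on the critical line, as a formula for `ζ ^ 2 Γ`. -/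
lemma zeta_sq_Gamma_eq (v : ℝ) :
    riemannZeta (1 / 2 + Complex.I * v) ^ 2 * Complex.Gamma (1 / 2 + Complex.I * v)
        * (2 : ℂ) ^ (-(Complex.I * v))
      = ((Real.sqrt Real.pi : ℝ) : ℂ)
        * ((‖riemannZeta (1 / 2 + Complex.I * v)‖ ^ 2 / Real.cosh (Real.pi * v) : ℝ) : ℂ)
        * ((Real.cosh (Real.pi * v / 2) + Real.sinh (Real.pi * v / 2) * Complex.I)
          * (Real.cos (v * Real.log Real.pi) + Real.sin (v * Real.log Real.pi) * Complex.I)) := by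
  set s : ℂ := 1 / 2 + Complex.I * v with hs
  have hre : s.re = 1 / 2 := by simp [s]
  have hfe := riemannZeta_one_sub (s := s)
    (fun n h => by
      have := congrArg Complex.re h
      rw [hre, Complex.neg_re, Complex.natCast_re] at this
      linarith [n.cast_nonneg (α := ℝ)])
    (critical_line_ne_one v)
  rw [show 1 - s = starRingEnd ℂ s by simp [s, Complex.ext_iff]; norm_num,
    riemannZeta_conj] at hfe
  have hpi : (Real.pi : ℂ) ≠ 0 := by exact_mod_cast Real.pi_ne_zero
  -- Multiplying the functional equation by ζ(s) gives |ζ|² on the left, as ζ(1 - s) is the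
  -- conjugate of ζ(s).
  have hmod : ((‖riemannZeta s‖ ^ 2 : ℝ) : ℂ)
      = 2 * (2 * Real.pi) ^ (-s) * Complex.Gamma s * Complex.cos (Real.pi * s / 2)
        * riemannZeta s ^ 2 := by
    rw [← Complex.normSq_eq_norm_sq, ← Complex.mul_conj, hfe]
    ring
  set w : ℂ := Real.cos (v * Real.log Real.pi) + Real.sin (v * Real.log Real.pi) * Complex.I
    with hw
  have hwexp : w = (Real.pi : ℂ) ^ (Complex.I * v) := by
    rw [Complex.cpow_def_of_ne_zero hpi, ← Complex.ofReal_log Real.pi_pos.le, hw,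
      Complex.ofReal_cos, Complex.ofReal_sin, ← Complex.exp_mul_I]
    congr 1
    push_cast
    ring
  have hw0 : w ≠ 0 := by
    rw [hwexp]; exact Complex.cpow_ne_zero_iff.2 (Or.inl hpi)
  have hq : ((Real.sqrt Real.pi : ℝ) : ℂ) ≠ 0 := by
    exact_mod_cast (Real.sqrt_pos.2 Real.pi_pos).ne'
  have hr2 : ((Real.sqrt 2 : ℝ) : ℂ) ≠ 0 := by
    exact_mod_cast (Real.sqrt_pos.2 two_pos).ne'
  have hsqrt (x : ℝ) (hx : 0 < x) : (x : ℂ) ^ (-s)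
      = (x : ℂ) ^ (-(Complex.I * v)) / ((Real.sqrt x : ℝ) : ℂ) := by
    have hx0 : (x : ℂ) ≠ 0 := by exact_mod_cast hx.ne'
    rw [Real.sqrt_eq_rpow, Complex.ofReal_cpow hx.le, ← Complex.cpow_sub _ _ hx0, hs]
    congr 1
    push_cast
    ring
  have hpow : (2 * (Real.pi : ℂ)) ^ (-s)
      = (2 : ℂ) ^ (-(Complex.I * v)) / ((Real.sqrt 2 : ℝ) : ℂ)
        * (1 / w / ((Real.sqrt Real.pi : ℝ) : ℂ)) := by
    have h1 := two_mul_cpow_neg Real.pi_pos.le s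
    have h2 := hsqrt 2 two_pos
    rw [Complex.ofReal_mul, Complex.ofReal_ofNat] at h1
    rw [Complex.ofReal_ofNat] at h2
    rw [h1, h2, hsqrt _ Real.pi_pos, Complex.cpow_neg (Real.pi : ℂ), ← hwexp, one_div]
  have hcos : Complex.cos (Real.pi * s / 2) = ((Real.sqrt 2 : ℝ) : ℂ) / 2 *
      (Real.cosh (Real.pi * v / 2) - Real.sinh (Real.pi * v / 2) * Complex.I) := by
    rw [show (Real.pi : ℂ) * s / 2
        = ((Real.pi / 4 : ℝ) : ℂ) + ((Real.pi * v / 2 : ℝ) : ℂ) * Complex.I by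
        rw [hs]; push_cast; ring,
      Complex.cos_add, Complex.cos_mul_I, Complex.sin_mul_I, ← Complex.ofReal_cos,
      ← Complex.ofReal_sin, Real.cos_pi_div_four, Real.sin_pi_div_four]
    push_cast
    ring
  -- This is (cosh - i sinh)(cosh + i sinh) at πv/2: it inverts the cosine factor and creates the
  -- denominator cosh(πv).
  have hcosh : (Real.cosh (Real.pi * v / 2) : ℂ) ^ 2 + (Real.sinh (Real.pi * v / 2) : ℂ) ^ 2
      = (Real.cosh (Real.pi * v) : ℂ) := by
    have := Real.cosh_two_mul (Real.pi * v / 2)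
    rw [mul_div_cancel₀ _ (two_ne_zero' ℝ)] at this
    exact_mod_cast this.symm
  have hc0 : (Real.cosh (Real.pi * v) : ℂ) ≠ 0 := by
    exact_mod_cast (Real.cosh_pos _).ne'
  rw [hpow, hcos] at hmod
  rw [Complex.ofReal_div, hmod, ← hcosh]
  rw [← hcosh] at hc0
  field_simp
  ring_nf
  simp only [Complex.I_sq]
  ring

end ZetaSquareIntegral

open ZetaSquareIntegral in
theorem mainTheorem8 :
    Summable (fun j : ℕ => 1 / (Real.exp (2 * ((j : ℝ) + 1)) - 1)) ∧
    MeasureTheory.Integrable (fun v : ℝ =>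
      riemannZeta (1 / 2 + Complex.I * v) ^ 2 * Complex.Gamma (1 / 2 + Complex.I * v)
        * (2 : ℂ) ^ (-(Complex.I * v))) ∧
    (∫ v : ℝ, riemannZeta (1 / 2 + Complex.I * v) ^ 2 * Complex.Gamma (1 / 2 + Complex.I * v)
        * (2 : ℂ) ^ (-(Complex.I * v)))
      = ((Real.sqrt 2 * Real.pi *
          (2 * (∑' j : ℕ, 1 / (Real.exp (2 * ((j : ℝ) + 1)) - 1))
            - Real.eulerMascheroniConstant + Real.log 2) : ℝ) : ℂ) ∧
    MeasureTheory.Integrable (fun v : ℝ =>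
      ‖riemannZeta (1 / 2 + Complex.I * v)‖ ^ 2 / Real.cosh (Real.pi * v) *
        (Real.sinh (Real.pi * v / 2) * Real.sin (v * Real.log Real.pi)
          - Real.cosh (Real.pi * v / 2) * Real.cos (v * Real.log Real.pi))) ∧
    (∫ v : ℝ, ‖riemannZeta (1 / 2 + Complex.I * v)‖ ^ 2 / Real.cosh (Real.pi * v) *
        (Real.sinh (Real.pi * v / 2) * Real.sin (v * Real.log Real.pi)
          - Real.cosh (Real.pi * v / 2) * Real.cos (v * Real.log Real.pi)))
      = -Real.sqrt (2 * Real.pi) *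
          (2 * (∑' j : ℕ, 1 / (Real.exp (2 * ((j : ℝ) + 1)) - 1))
            - Real.eulerMascheroniConstant + Real.log 2) := by
  have hq : Real.sqrt Real.pi ≠ 0 := (Real.sqrt_pos.2 Real.pi_pos).ne'
  -- The real part of the product in `zeta_sq_Gamma_eq` contains cosh·cos - sinh·sin, hence the
  -- minus sign; dividing by √π later turns √2 π into √(2π).
  have hre (v : ℝ) : ‖riemannZeta (1 / 2 + Complex.I * v)‖ ^ 2 / Real.cosh (Real.pi * v) *
        (Real.sinh (Real.pi * v / 2) * Real.sin (v * Real.log Real.pi)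
          - Real.cosh (Real.pi * v / 2) * Real.cos (v * Real.log Real.pi))
      = -(Real.sqrt Real.pi)⁻¹ * RCLike.re (riemannZeta (1 / 2 + Complex.I * v) ^ 2
        * Complex.Gamma (1 / 2 + Complex.I * v) * (2 : ℂ) ^ (-(Complex.I * v))) := by
    rw [zeta_sq_Gamma_eq, ← Complex.ofReal_mul, RCLike.re_eq_complex_re, Complex.re_ofReal_mul]
    simp only [Complex.mul_re, Complex.add_re, Complex.add_im, Complex.mul_im, Complex.ofReal_re,
      Complex.ofReal_im, Complex.I_re, Complex.I_im]
    field_simp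
    ring
  refine ⟨summable_one_div_exp_sub_one, integrable_zeta_sq_Gamma, integral_zeta_sq_Gamma, ?_, ?_⟩
  · simp_rw [hre]
    exact integrable_zeta_sq_Gamma.re.const_mul _
  · simp_rw [hre]
    rw [integral_const_mul, integral_re integrable_zeta_sq_Gamma, integral_zeta_sq_Gamma,
      RCLike.re_eq_complex_re, Complex.ofReal_re, Real.sqrt_mul zero_le_two]
    have : Real.sqrt Real.pi ^ 2 = Real.pi := Real.sq_sqrt Real.pi_pos.le
    field_simp
    rw [this]
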